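/- For real $\ell\ge 0$ let $f_\ell(r)=(1-r^2)^\ell$ for $0\le r\le 1$ and $f_\ell(r)=0$ for $r>1$, and let $(f_\ell*f_\ell)(r)=\int_{\mathbb R}f_\ell(|t|)\,f_\ell(|r-t|)\,dt$ for $r\ge 0$. For functions on $[0,\infty)$ put $I_0\varphi=\varphi$, $I_\nu\varphi(r)=\int_r^\infty\frac{(x-r)^{\nu-1}}{\Gamma(\nu)}\varphi(x)\,dx$ for $\nu>0$, $I_{-n}\varphi=(-1)^n\varphi^{(n)}$ for $n\in\mathbb N$ (one-sided derivatives at $0$), and $I_{-\nu}=I_{n-\nu}I_{-n}$ with $n=\lceil\nu\rceil$ for $\nu>0$. For real $0\le k\le\ell$ the generalized Wu function $\varphi_{\ell,k}$ is $$\varphi_{\ell,k}(r)=\bigl(I_{-k}\,g_\ell\bigr)(r^2/2),\qquad g_\ell(s)=(f_\ell*f_\ell)(\sqrt{2s}),\qquad r\ge 0 .$$ Write $a^{(0)}=1$, $a^{(n)}=a(a+1)\cdots(a+n-1)$ for $n\ge1$, and ${}_2F_1(a,b;c;z)=\sum_{m\ge0}\frac{a^{(m)}b^{(m)}}{c^{(m)}}\frac{z^m}{m!}$.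 **Theorem.** Let $\ell\in\mathbb N=\{0,1,2,\dots\}$, let $k$ be real with $0\le k\le\ell$, and let $0\le r\le 2$. Then $\varphi_{\ell,k}(r)$ is well defined (the function $g_\ell$ is $\lceil k\rceil$ times continuously differentiable on $[0,\infty)$, and for non-integer $k$ the integral defining $I_{\lceil k\rceil-k}I_{-\lceil k\rceil}g_\ell$ at $r^2/2$ converges absolutely), the hypergeometric series below converge, and $$\varphi_{\ell,k}(r)=\frac{2^{2\ell-k+1}\,\Gamma(\ell+1)}{\Gamma(\ell-k+1)}\left(1-\frac{r^2}{4}\right)^{\ell-k}\left[\frac{1^{(\ell)}}{(3/2)^{(\ell)}}-\sum_{n=0}^{\ell}\frac{(-\ell)^{(n)}(1/2)^{(n)}}{(3/2)^{(n)}}\,\frac1{n!}\;{}_2F_1\!\left(-n-\tfrac12,\,1;\,\ell-k+1;\,1-\tfrac{r^2}{4}\right)\right],$$ where $0^0=1$. -/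

import Mathlib

open MeasureTheory

namespace WuFunction

noncomputable section

/-- The `f`-form of a function on `[0, ∞)`: `r ↦ φ (√(2r))`. -/
def fForm (φ : ℝ → ℝ) (r : ℝ) : ℝ := φ (Real.sqrt (2 * r))

/-- The inverse `f`-form of a function on `[0, ∞)`: `r ↦ φ (r² / 2)`. -/
def fFormInv (φ : ℝ → ℝ) (r : ℝ) : ℝ := φ (r ^ 2 / 2)

/-- The integrand of the fractional integral of order `ν > 0` at the point `r`. -/
def fracIntegrand (ν : ℝ) (φ : ℝ → ℝ) (r x : ℝ) : ℝ :=
  (x - r) ^ (ν - 1) / Real.Gamma ν * φ x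

/-- The fractional integral `I_ν` of order `ν ≥ 0`; `I_0` is the identity. -/
def fracInt (ν : ℝ) (φ : ℝ → ℝ) (r : ℝ) : ℝ :=
  if ν = 0 then φ r else ∫ x in Set.Ioi r, fracIntegrand ν φ r x

/-- The operator `I_{-n} = (-1)ⁿ dⁿ/drⁿ` on functions on `[0, ∞)`; the derivatives at `0` are
one-sided. -/
def negDeriv (n : ℕ) (φ : ℝ → ℝ) (r : ℝ) : ℝ :=
  (-1) ^ n * iteratedDerivWithin n φ (Set.Ici 0) r

/-- The fractional derivative `I_{-ν} = I_{n-ν} I_{-n}` with `n = ⌈ν⌉`, for `ν ≥ 0`. -/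
def fracDeriv (ν : ℝ) (φ : ℝ → ℝ) : ℝ → ℝ :=
  fracInt (⌈ν⌉₊ - ν) (negDeriv ⌈ν⌉₊ φ)

/-- The fractional derivative of order `ν` exists at `r` in the genuine sense: `φ` is `n = ⌈ν⌉`
times continuously differentiable on `[0, ∞)`, and, if `ν` is not an integer, the integral
`I_{n-ν}` of its `n`-th derivative converges absolutely at `r`. -/
def FracDerivExistsAt (ν : ℝ) (φ : ℝ → ℝ) (r : ℝ) : Prop :=
  ContDiffOn ℝ ⌈ν⌉₊ φ (Set.Ici 0) ∧
    ((⌈ν⌉₊ : ℝ) ≠ ν →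
      IntegrableOn (fracIntegrand (⌈ν⌉₊ - ν) (negDeriv ⌈ν⌉₊ φ) r) (Set.Ioi r))

/-- The operator `𝒟^k`, whose `f`-form is the fractional derivative `I_{-k}`. -/
def walkD (k : ℝ) (φ : ℝ → ℝ) : ℝ → ℝ := fFormInv (fracDeriv k (fForm φ))

/-- The function `f_ℓ(r) = (1 - r²)_+^ℓ`; it vanishes for `r > 1` also when `ℓ = 0`. -/
def truncPow (ℓ : ℝ) (r : ℝ) : ℝ := if |r| ≤ 1 then (1 - r ^ 2) ^ ℓ else 0

/-- The convolution of the even functions `x ↦ φ |x|` and `x ↦ ψ |x|` on the real line. -/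
def radialConv (φ ψ : ℝ → ℝ) : ℝ → ℝ :=
  convolution (fun x => φ |x|) (fun x => ψ |x|) (ContinuousLinearMap.mul ℝ ℝ) volume

/-- The generalized Wu function `φ_{ℓ,k} = 𝒟^k (f_ℓ * f_ℓ)`. -/
def wu (ℓ k : ℝ) : ℝ → ℝ := walkD k (radialConv (truncPow ℓ) (truncPow ℓ))

/-- The Pochhammer symbol `a^{(n)} = a (a + 1) ⋯ (a + n - 1)`. -/
def poch (a : ℝ) (n : ℕ) : ℝ := (ascPochhammer ℝ n).eval a

end

end WuFunction

namespace WuFunction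

/-! At r = 2c with 0 ≤ c ≤ 1 the convolution is the integral of ((1 - t²)(1 - (2c - t)²))^ℓ over [2c
- 1, 1]. Centring at t = c gives powers of a biquadratic with zeros ±1 ± c, in which the dependence
on r² is hard to differentiate. The key is `integral_quadratic_transformation`, which turns this
integral into 2·4^ℓ ∫_c^1 ((y² - c²)(1 - y²))^ℓ dy. With s = r²/2 = 2c² it says that g_ℓ(s) = 2·4^ℓ
∫_0^1 (y² - s/2)_+^ℓ (1 - y²)^ℓ dy, a superposition of truncated powers of affine functions of s
(`fForm_radialConv_truncPow`).

Derivatives and fractional integrals in s only shift the exponent of a truncated power and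
contribute Gamma factors. Hence I_{-k} g_ℓ is a constant times the same integral with (y² -
s/2)_+^(ℓ-k) (`fracDeriv_fForm_radialConv`), for integer and fractional k alike.

It remains to expand (1 - y²)^ℓ in powers of y². The substitution t = 1 - y² makes each moment an
Euler integral equal to a multiple of 1 - ₂F₁ (`setIntegral_sq_sub_sq_rpow`). The constants 1 add up
to ∫_0^1 (1 - y²)^ℓ dy, the Pochhammer quotient of the formula. -/

/-! ### Quadratic transformation of the convolution integral -/

/-- Three-term recurrence for the moments of a biquadratic polynomial between two of its zeros. -/
lemma integral_biquadratic_pow_recurrence (a d u v : ℝ)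
    (hu : u ^ 4 - 2 * a * u ^ 2 + d = 0) (hv : v ^ 4 - 2 * a * v ^ 2 + d = 0) (n : ℕ) :
    (4 * n + 7) * (4 * n + 9) * ∫ x in u..v, (x ^ 4 - 2 * a * x ^ 2 + d) ^ (n + 2) =
      4 * (n + 2) * (4 * (n + 1) * (d * (a ^ 2 - d)) * (∫ x in u..v, (x ^ 4 - 2 * a * x ^ 2 + d) ^ n)
        + (4 * n + 6) * (2 * d - a ^ 2) *
          ∫ x in u..v, (x ^ 4 - 2 * a * x ^ 2 + d) ^ (n + 1)) := by
  -- Write P for the biquadratic. The cubic R = (2a² - d)x - ax³ is the one with R P' ≡ -4d(a² - d)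
  -- mod P. The weights 4n + 7 and 4(n + 2) cancel the x² P^(n+1) terms in the derivatives of x
  -- P^(n+2) and R P^(n+1). Boundary terms vanish because P(u) = P(v) = 0.
  have hder : ∀ x ∈ Set.uIcc u v, HasDerivAt
      (fun x : ℝ => ((4 * n + 7) * (x * (x ^ 4 - 2 * a * x ^ 2 + d))
        + 4 * (n + 2) * ((2 * a ^ 2 - d) * x - a * x ^ 3)) * (x ^ 4 - 2 * a * x ^ 2 + d) ^ (n + 1))
      ((4 * n + 7) * (4 * n + 9) * (x ^ 4 - 2 * a * x ^ 2 + d) ^ (n + 2)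
        - (4 * (n + 2) * (4 * (n + 1) * (d * (a ^ 2 - d)))) * (x ^ 4 - 2 * a * x ^ 2 + d) ^ n
        - (4 * (n + 2) * ((4 * n + 6) * (2 * d - a ^ 2))) *
            (x ^ 4 - 2 * a * x ^ 2 + d) ^ (n + 1)) x := by
    intro x _
    have h1 : HasDerivAt (fun x : ℝ => x ^ 4 - 2 * a * x ^ 2 + d) (4 * x ^ 3 - 4 * a * x) x := by
      have := (((hasDerivAt_id x).pow 4).sub (((hasDerivAt_id x).pow 2).const_mul (2 * a))).add_const d
      refine this.congr_deriv ?_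
      simp; ring
    have h2 := ((((hasDerivAt_id x).mul h1).const_mul (4 * (n : ℝ) + 7)).add
      ((((hasDerivAt_id x).const_mul (2 * a ^ 2 - d)).sub
        (((hasDerivAt_id x).pow 3).const_mul a)).const_mul (4 * ((n : ℝ) + 2)))).mul (h1.pow (n + 1))
    refine h2.congr_deriv ?_
    simp
    ring
  have hc : Continuous fun x : ℝ => x ^ 4 - 2 * a * x ^ 2 + d := by fun_prop
  have hi : ∀ (m : ℕ) (b : ℝ), IntervalIntegrable
      (fun x : ℝ => b * (x ^ 4 - 2 * a * x ^ 2 + d) ^ m) volume u v :=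
    fun m b => ((hc.pow m).const_mul b).intervalIntegrable _ _
  have key := intervalIntegral.integral_eq_sub_of_hasDerivAt hder
    (((hi _ _).sub (hi _ _)).sub (hi _ _))
  rw [intervalIntegral.integral_sub ((hi _ _).sub (hi _ _)) (hi _ _),
    intervalIntegral.integral_sub (hi _ _) (hi _ _)] at key
  simp only [intervalIntegral.integral_const_mul, hu, hv, ne_eq, Nat.add_eq_zero_iff, one_ne_zero,
    and_false, not_false_eq_true, zero_pow, mul_zero, sub_zero] at key
  linear_combination key

/-- A quadratic transformation between two families of (hyper)elliptic integrals. -/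
lemma integral_quadratic_transformation (c : ℝ) (n : ℕ) :
    ∫ x in (c - 1)..(1 - c), (x ^ 4 - 2 * (1 + c ^ 2) * x ^ 2 + (1 - c ^ 2) ^ 2) ^ n =
      2 * 4 ^ n * ∫ y in c..1, ((y ^ 2 - c ^ 2) * (1 - y ^ 2)) ^ n := by
  have hneg : ∀ n : ℕ, ∫ y in c..1, ((y ^ 2 - c ^ 2) * (1 - y ^ 2)) ^ n =
      (-1) ^ n * ∫ y in c..1, (y ^ 4 - 2 * ((1 + c ^ 2) / 2) * y ^ 2 + c ^ 2) ^ n := by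
    intro n
    rw [← intervalIntegral.integral_const_mul]
    refine intervalIntegral.integral_congr fun y _ => ?_
    simp only [← mul_pow]
    ring
  induction n using Nat.twoStepInduction with
  | zero => simp; ring
  | one =>
    have h1 : ∀ a d u v : ℝ, ∫ x in u..v, (x ^ 4 - 2 * a * x ^ 2 + d) ^ 1 =
        (v ^ 5 - u ^ 5) / 5 - 2 * a * ((v ^ 3 - u ^ 3) / 3) + d * (v - u) := by
      intro a d u v
      simp only [pow_one]
      rw [intervalIntegral.integral_add ((by fun_prop : Continuous _).intervalIntegrable _ _)
        ((by fun_prop : Continuous _).intervalIntegrable _ _),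
        intervalIntegral.integral_sub ((by fun_prop : Continuous _).intervalIntegrable _ _)
        ((by fun_prop : Continuous _).intervalIntegrable _ _)]
      simp
      norm_num
      ring
    rw [hneg, h1, h1]
    ring
  | more n ih0 ih1 =>
    rw [hneg] at ih0 ih1 ⊢
    -- Both families obey the same recurrence up to the scaling by (-4)^n: from the second pair (a,
    -- d) to the first, d(a² - d) gets multiplied by 16 and 2d - a² by -4.
    have hP := integral_biquadratic_pow_recurrence (1 + c ^ 2) ((1 - c ^ 2) ^ 2) (c - 1) (1 - c)
      (by ring) (by ring) n
    have hQ := integral_biquadratic_pow_recurrence ((1 + c ^ 2) / 2) (c ^ 2) c 1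
      (by ring) (by ring) n
    rw [ih0, ih1] at hP
    have hne : (4 * (n : ℝ) + 7) * (4 * n + 9) ≠ 0 := by positivity
    refine mul_left_cancel₀ hne ?_
    rw [hP]
    linear_combination (-(2 * 4 ^ (n + 2) * (-1) ^ (n + 2))) * hQ

/-! ### The convolution as a superposition of truncated powers -/

/-- The truncated power `u ↦ u_+^q`, which vanishes at `u ≤ 0` also when `q = 0`. -/
noncomputable def posPow (q u : ℝ) : ℝ := if 0 < u then u ^ q else 0

/-- The integral `∫₀¹ (y² - s/2)_+^q (1 - y²)^ℓ dy`. -/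
noncomputable def posPowIntegral (ℓ : ℕ) (q s : ℝ) : ℝ :=
  ∫ y in Set.Ioc 0 1, posPow q (y ^ 2 - s / 2) * (1 - y ^ 2) ^ ℓ

lemma posPowIntegral_eq_setIntegral (ℓ : ℕ) (q : ℝ) {c s : ℝ} (hc : 0 ≤ c)
    (hs : s / 2 = c ^ 2) :
    posPowIntegral ℓ q s = ∫ y in Set.Ioc c 1, (y ^ 2 - c ^ 2) ^ q * (1 - y ^ 2) ^ ℓ := by
  have h1 : ∀ y : ℝ, Set.indicator (Set.Ioc 0 1)
      (fun y => posPow q (y ^ 2 - s / 2) * (1 - y ^ 2) ^ ℓ) y =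
      Set.indicator (Set.Ioc c 1) (fun y => (y ^ 2 - c ^ 2) ^ q * (1 - y ^ 2) ^ ℓ) y := by
    intro y
    simp only [Set.indicator, Set.mem_Ioc, posPow, hs]
    by_cases hy : c < y
    · have h0 : 0 < y := hc.trans_lt hy
      have h2 : 0 < y ^ 2 - c ^ 2 := by nlinarith
      simp [hy, h0, h2]
    · by_cases h0 : 0 < y
      · have h2 : ¬ 0 < y ^ 2 - c ^ 2 := by nlinarith
        simp [hy, h2]
      · simp [hy, h0]
  rw [posPowIntegral, ← integral_indicator measurableSet_Ioc, ← integral_indicator measurableSet_Ioc]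
  exact integral_congr_ae (Filter.Eventually.of_forall h1)

lemma truncPow_abs (ℓ : ℕ) (t : ℝ) :
    truncPow ℓ |t| = if t ∈ Set.Icc (-1) 1 then (1 - t ^ 2) ^ ℓ else 0 := by
  simp [truncPow, abs_le]

lemma radialConv_truncPow_eq_setIntegral (ℓ : ℕ) {r : ℝ} (hr : 0 ≤ r) :
    radialConv (truncPow ℓ) (truncPow ℓ) r =
      ∫ t in Set.Icc (r - 1) 1, ((1 - t ^ 2) * (1 - (r - t) ^ 2)) ^ ℓ := by
  rw [radialConv, convolution, ← integral_indicator measurableSet_Icc]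
  refine integral_congr_ae (Filter.Eventually.of_forall fun t => ?_)
  simp only [ContinuousLinearMap.mul_apply', truncPow_abs, Set.indicator, mul_pow]
  by_cases h : t ∈ Set.Icc (r - 1) 1
  · have h1 : t ∈ Set.Icc (-1 : ℝ) 1 := ⟨by linarith [h.1], h.2⟩
    have h2 : r - t ∈ Set.Icc (-1 : ℝ) 1 := ⟨by linarith [h.2], by linarith [h.1]⟩
    rw [if_pos h, if_pos h1, if_pos h2]
  · rw [if_neg h]
    by_cases h1 : t ∈ Set.Icc (-1 : ℝ) 1
    · have h2 : r - t ∉ Set.Icc (-1 : ℝ) 1 := fun h2 => h ⟨by linarith [h2.2], h1.2⟩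
      rw [if_neg h2, mul_zero]
    · rw [if_neg h1, zero_mul]

lemma fForm_radialConv_truncPow (ℓ : ℕ) {s : ℝ} (hs : 0 ≤ s) :
    fForm (radialConv (truncPow ℓ) (truncPow ℓ)) s = 2 * 4 ^ ℓ * posPowIntegral ℓ ℓ s := by
  obtain ⟨c, hc, hcs⟩ : ∃ c : ℝ, 0 ≤ c ∧ s / 2 = c ^ 2 :=
    ⟨√(s / 2), Real.sqrt_nonneg _, (Real.sq_sqrt (by positivity)).symm⟩
  have hr : √(2 * s) = 2 * c := by
    rw [show 2 * s = (2 * c) ^ 2 by nlinarith]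
    exact Real.sqrt_sq (by positivity)
  rw [fForm, hr, radialConv_truncPow_eq_setIntegral ℓ (by positivity),
    posPowIntegral_eq_setIntegral ℓ ℓ hc hcs]
  -- For c ≤ 1, translation by c centres the overlap of the two supports at 0; for c > 1 both
  -- domains of integration are empty.
  rcases le_or_gt c 1 with h1 | h1
  · rw [integral_Icc_eq_integral_Ioc, ← intervalIntegral.integral_of_le (by linarith),
      ← intervalIntegral.integral_of_le h1]
    have hsub := intervalIntegral.integral_comp_add_right
      (fun t => ((1 - t ^ 2) * (1 - (2 * c - t) ^ 2)) ^ ℓ) c (a := c - 1) (b := 1 - c)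
    rw [show c - 1 + c = 2 * c - 1 by ring, show 1 - c + c = 1 by ring] at hsub
    have h := integral_quadratic_transformation c ℓ
    rw [← hsub]
    simp only [Real.rpow_natCast, ← mul_pow] at h ⊢
    rw [← h]
    refine intervalIntegral.integral_congr fun x _ => ?_
    refine congrArg (· ^ ℓ) ?_
    ring
  · rw [Set.Icc_eq_empty (by linarith), Set.Ioc_eq_empty (by linarith)]
    simp

/-! ### Smoothness and integer derivatives of the superposition -/

lemma measurable_posPow (q : ℝ) : Measurable (posPow q) :=
  Measurable.ite measurableSet_Ioi (measurable_id.pow_const q) measurable_const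

lemma posPow_nonneg (q u : ℝ) : 0 ≤ posPow q u := by
  unfold posPow
  split_ifs with h
  · positivity
  · rfl

lemma posPow_of_pos (q : ℝ) {u : ℝ} (hu : 0 < u) : posPow q u = u ^ q := if_pos hu

lemma posPow_of_nonpos (q : ℝ) {u : ℝ} (hu : u ≤ 0) : posPow q u = 0 := if_neg hu.not_gt

lemma posPow_le_rpow {q u b : ℝ} (hq : 0 ≤ q) (hb : 0 ≤ b) (hub : u ≤ b) : posPow q u ≤ b ^ q := by
  rcases lt_or_ge 0 u with h | h
  · rw [posPow_of_pos q h]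
    exact Real.rpow_le_rpow h.le hub hq
  · rw [posPow_of_nonpos q h]
    positivity

lemma continuousAt_posPow (q : ℝ) {u : ℝ} (hu : u ≠ 0) : ContinuousAt (posPow q) u := by
  rcases lt_or_gt_of_ne hu with h | h
  · refine (continuousAt_const (y := (0 : ℝ))).congr ?_
    filter_upwards [Iio_mem_nhds h] with v hv using (posPow_of_nonpos q (le_of_lt hv)).symm
  · refine (Real.continuousAt_rpow_const u q (Or.inl hu)).congr ?_
    filter_upwards [Ioi_mem_nhds h] with v hv using (posPow_of_pos q hv).symm

lemma hasDerivAt_posPow (q : ℝ) {u : ℝ} (hu : u ≠ 0) :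
    HasDerivAt (posPow q) (q * posPow (q - 1) u) u := by
  rcases lt_or_gt_of_ne hu with h | h
  · rw [posPow_of_nonpos _ h.le, mul_zero]
    refine (hasDerivAt_const u (0 : ℝ)).congr_of_eventuallyEq ?_
    filter_upwards [Iio_mem_nhds h] with v hv using posPow_of_nonpos q (le_of_lt hv)
  · rw [posPow_of_pos _ h]
    refine (Real.hasDerivAt_rpow_const (Or.inl hu)).congr_of_eventuallyEq ?_
    filter_upwards [Ioi_mem_nhds h] with v hv using posPow_of_pos q hv

lemma posPow_natCast_succ (p : ℕ) (u : ℝ) : posPow ((p + 1 : ℕ) : ℝ) u = max u 0 ^ (p + 1) := by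
  rcases lt_or_ge 0 u with h | h
  · rw [posPow_of_pos _ h, max_eq_left h.le, Real.rpow_natCast]
  · rw [posPow_of_nonpos _ h, max_eq_right h, zero_pow (Nat.succ_ne_zero p)]

lemma abs_posPow_sub_posPow_le (p : ℕ) {u v b : ℝ} (hb : 0 ≤ b) (hu : u ≤ b) (hv : v ≤ b) :
    |posPow ((p + 1 : ℕ) : ℝ) u - posPow ((p + 1 : ℕ) : ℝ) v| ≤ (p + 1) * b ^ p * |u - v| := by
  rw [posPow_natCast_succ, posPow_natCast_succ]
  refine (abs_pow_sub_pow_le _ _ _).trans ?_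
  rw [abs_of_nonneg (le_max_right u 0), abs_of_nonneg (le_max_right v 0)]
  have h1 : |max u 0 - max v 0| ≤ |u - v| := abs_max_sub_max_le_abs u v 0
  have h2 : max (max u 0) (max v 0) ≤ b := max_le (max_le hu hb) (max_le hv hb)
  have h3 : 0 ≤ max (max u 0) (max v 0) := (le_max_right u 0).trans (le_max_left _ _)
  calc |max u 0 - max v 0| * ((p + 1 : ℕ) : ℝ) * max (max u 0) (max v 0) ^ (p + 1 - 1)
      ≤ |u - v| * ((p + 1 : ℕ) : ℝ) * b ^ (p + 1 - 1) := by gcongr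
    _ = (p + 1) * b ^ p * |u - v| := by push_cast; ring

lemma aestronglyMeasurable_posPow_mul (ℓ : ℕ) (q s : ℝ) (μ : Measure ℝ) :
    AEStronglyMeasurable (fun y => posPow q (y ^ 2 - s / 2) * (1 - y ^ 2) ^ ℓ) μ :=
  (((measurable_posPow q).comp (by fun_prop)).mul (by fun_prop)).aestronglyMeasurable

lemma one_sub_sq_pow_mem_Icc (ℓ : ℕ) {y : ℝ} (hy : y ∈ Set.Ioc (0 : ℝ) 1) :
    (1 - y ^ 2) ^ ℓ ∈ Set.Icc (0 : ℝ) 1 := by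
  have h1 : 0 ≤ 1 - y ^ 2 := by nlinarith [hy.1, hy.2]
  exact ⟨pow_nonneg h1 ℓ, pow_le_one₀ h1 (by nlinarith [sq_nonneg y])⟩

lemma norm_posPow_mul_le (ℓ : ℕ) {q s b y : ℝ} (hq : 0 ≤ q) (hs : |s| ≤ b)
    (hy : y ∈ Set.Ioc (0 : ℝ) 1) :
    ‖posPow q (y ^ 2 - s / 2) * (1 - y ^ 2) ^ ℓ‖ ≤ (1 + b) ^ q := by
  have hb : 0 ≤ b := (abs_nonneg s).trans hs
  obtain ⟨hw0, hw1⟩ := one_sub_sq_pow_mem_Icc ℓ hy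
  rw [Real.norm_eq_abs, abs_of_nonneg (mul_nonneg (posPow_nonneg _ _) hw0)]
  have h2 : posPow q (y ^ 2 - s / 2) ≤ (1 + b) ^ q :=
    posPow_le_rpow hq (by positivity) (by nlinarith [hy.1, hy.2, neg_abs_le s])
  nlinarith [posPow_nonneg q (y ^ 2 - s / 2)]

lemma integrableOn_posPow_mul (ℓ : ℕ) {q : ℝ} (hq : 0 ≤ q) (s : ℝ) :
    IntegrableOn (fun y => posPow q (y ^ 2 - s / 2) * (1 - y ^ 2) ^ ℓ) (Set.Ioc 0 1) := by
  refine Measure.integrableOn_of_bounded (M := (1 + |s|) ^ q) (by simp)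
    (aestronglyMeasurable_posPow_mul ℓ q s _) ?_
  filter_upwards [ae_restrict_mem measurableSet_Ioc] with y hy
  exact norm_posPow_mul_le ℓ hq le_rfl hy

lemma ae_sq_sub_ne_zero (s : ℝ) (t : Set ℝ) :
    ∀ᵐ y ∂(volume.restrict t), y ^ 2 - s / 2 ≠ 0 := by
  refine ae_restrict_of_ae ?_
  have hfin : ({√(s / 2), -√(s / 2)} : Set ℝ).Finite := Set.toFinite _
  filter_upwards [hfin.countable.ae_notMem volume] with y hy h
  apply hy
  have h1 : y ^ 2 = √(s / 2) ^ 2 := by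
    rw [Real.sq_sqrt] <;> nlinarith [sq_nonneg y]
  exact sq_eq_sq_iff_eq_or_eq_neg.mp h1

lemma continuous_posPowIntegral (ℓ : ℕ) {q : ℝ} (hq : 0 ≤ q) :
    Continuous (posPowIntegral ℓ q) := by
  refine continuous_iff_continuousAt.mpr fun s => ?_
  refine continuousAt_of_dominated (bound := fun _ => (1 + (|s| + 1)) ^ q) ?_ ?_ ?_ ?_
  · exact Filter.Eventually.of_forall fun x => aestronglyMeasurable_posPow_mul ℓ q x _
  · filter_upwards [Metric.ball_mem_nhds s one_pos] with x hx
    filter_upwards [ae_restrict_mem measurableSet_Ioc] with y hy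
    refine norm_posPow_mul_le ℓ hq ?_ hy
    have h := abs_sub_abs_le_abs_sub x s
    rw [Metric.mem_ball, Real.dist_eq] at hx
    linarith
  · exact integrable_const _
  · filter_upwards [ae_sq_sub_ne_zero s (Set.Ioc 0 1)] with y hy
    refine ContinuousAt.mul ?_ continuousAt_const
    exact ContinuousAt.comp (g := posPow q) (f := fun x : ℝ => y ^ 2 - x / 2)
      (continuousAt_posPow q hy) (by fun_prop)

/-- Differentiation under the integral in its Lipschitz form: for p = 0 the integrand has a kink in
s, but at a fixed s only a null set of y sees it. -/
lemma hasDerivAt_posPowIntegral (ℓ p : ℕ) (s : ℝ) :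
    HasDerivAt (posPowIntegral ℓ ((p + 1 : ℕ) : ℝ))
      (-((p + 1) / 2) * posPowIntegral ℓ p s) s := by
  have hmain := hasDerivAt_integral_of_dominated_loc_of_lip (μ := volume.restrict (Set.Ioc 0 1))
    (F := fun x y => posPow ((p + 1 : ℕ) : ℝ) (y ^ 2 - x / 2) * (1 - y ^ 2) ^ ℓ)
    (F' := fun y => -((p + 1) / 2) * (posPow p (y ^ 2 - s / 2) * (1 - y ^ 2) ^ ℓ))
    (bound := fun _ => (p + 1) * (|s| + 2) ^ p) (Metric.ball_mem_nhds s one_pos)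
    (Filter.Eventually.of_forall fun x => aestronglyMeasurable_posPow_mul ℓ _ x _)
    (integrableOn_posPow_mul ℓ (by positivity) s)
    ((aestronglyMeasurable_posPow_mul ℓ _ s _).const_mul _) ?_ (integrable_const _) ?_
  · rw [integral_const_mul] at hmain
    exact hmain.2
  · filter_upwards [ae_restrict_mem measurableSet_Ioc] with y hy
    refine LipschitzOnWith.of_dist_le_mul fun x hx z hz => ?_
    have hle : ∀ x ∈ Metric.ball s 1, y ^ 2 - x / 2 ≤ |s| + 2 := by
      intro x hx
      rw [Metric.mem_ball, Real.dist_eq, abs_lt] at hx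
      nlinarith [hy.1, hy.2, neg_abs_le s, abs_nonneg s]
    have hb := abs_posPow_sub_posPow_le p (by positivity) (hle x hx) (hle z hz)
    obtain ⟨hw0, hw1⟩ := one_sub_sq_pow_mem_Icc ℓ hy
    have hL : 0 ≤ ((p : ℝ) + 1) * (|s| + 2) ^ p := by positivity
    rw [Real.dist_eq, Real.dist_eq, ← sub_mul, abs_mul, abs_of_nonneg hw0, Real.coe_nnabs,
      abs_of_nonneg hL]
    have hxz : |y ^ 2 - x / 2 - (y ^ 2 - z / 2)| ≤ |x - z| := by
      rw [show y ^ 2 - x / 2 - (y ^ 2 - z / 2) = -((x - z) / 2) by ring, abs_neg, abs_div, abs_two]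
      linarith [abs_nonneg (x - z)]
    refine (mul_le_of_le_one_right (abs_nonneg _) hw1).trans (hb.trans ?_)
    gcongr
  · filter_upwards [ae_sq_sub_ne_zero s (Set.Ioc 0 1)] with y hy
    have h1 : HasDerivAt (fun x : ℝ => y ^ 2 - x / 2) (-(1 / 2)) s :=
      ((hasDerivAt_id s).div_const 2).const_sub (y ^ 2)
    refine (((hasDerivAt_posPow ((p + 1 : ℕ) : ℝ) hy).comp s h1).mul_const _).congr_deriv ?_
    push_cast
    rw [add_sub_cancel_right]
    ring

/-- Averaging over y gains one order of smoothness: u_+^p itself is not C^p, but the jump reached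
after p derivatives is integrated out. -/
lemma contDiff_posPowIntegral (ℓ p : ℕ) : ContDiff ℝ p (posPowIntegral ℓ p) := by
  induction p with
  | zero =>
    rw [Nat.cast_zero, contDiff_zero]
    exact continuous_posPowIntegral ℓ (Nat.cast_nonneg 0)
  | succ p ih =>
    have hd : deriv (posPowIntegral ℓ ((p + 1 : ℕ) : ℝ)) =
        fun s => -((p + 1) / 2) * posPowIntegral ℓ p s :=
      funext fun s => (hasDerivAt_posPowIntegral ℓ p s).deriv
    have h := (contDiff_succ_iff_deriv (𝕜 := ℝ) (n := (p : WithTop ℕ∞))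
      (f := posPowIntegral ℓ ((p + 1 : ℕ) : ℝ))).mpr
      ⟨fun s => (hasDerivAt_posPowIntegral ℓ p s).differentiableAt, by simp, by
        rw [hd]; exact contDiff_const.mul ih⟩
    simpa using h

lemma iteratedDeriv_posPowIntegral (ℓ p n : ℕ) :
    iteratedDeriv n (posPowIntegral ℓ ((p + n : ℕ) : ℝ)) = fun s =>
      (-1 / 2) ^ n * ((p + n).factorial / p.factorial) * posPowIntegral ℓ p s := by
  induction n with
  | zero =>
    have : (p.factorial : ℝ) ≠ 0 := by positivity
    ext s
    simp [this]
  | succ n ih =>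
    rw [iteratedDeriv_succ']
    have hd : deriv (posPowIntegral ℓ ((p + (n + 1) : ℕ) : ℝ)) =
        fun s => -(((p + n : ℕ) + 1) / 2) * posPowIntegral ℓ ((p + n : ℕ) : ℝ) s :=
      funext fun s => (hasDerivAt_posPowIntegral ℓ (p + n) s).deriv
    rw [hd]
    ext s
    rw [iteratedDeriv_const_mul_field, ih, ← add_assoc, Nat.factorial_succ]
    push_cast
    ring

lemma contDiffOn_fForm_radialConv (ℓ n : ℕ) (hn : n ≤ ℓ) :
    ContDiffOn ℝ n (fForm (radialConv (truncPow ℓ) (truncPow ℓ))) (Set.Ici 0) :=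
  ((contDiff_const.mul ((contDiff_posPowIntegral ℓ ℓ).of_le (by exact_mod_cast hn))).contDiffOn).congr
    fun _ hs => fForm_radialConv_truncPow ℓ hs

/-- The integral over y is C^ℓ on the whole line and extends g_ℓ, so one-sided derivatives at 0 are
ordinary derivatives of the extension. -/
lemma negDeriv_fForm_radialConv (ℓ n : ℕ) (hn : n ≤ ℓ) {s : ℝ} (hs : 0 ≤ s) :
    negDeriv n (fForm (radialConv (truncPow ℓ) (truncPow ℓ))) s =
      2 * 4 ^ ℓ / 2 ^ n * (ℓ.factorial / (ℓ - n).factorial) *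
        posPowIntegral ℓ ((ℓ - n : ℕ) : ℝ) s := by
  have hcongr : Set.EqOn (fForm (radialConv (truncPow ℓ) (truncPow ℓ)))
      (fun s => 2 * 4 ^ ℓ * posPowIntegral ℓ ℓ s) (Set.Ici 0) :=
    fun _ hs => fForm_radialConv_truncPow ℓ hs
  obtain ⟨p, rfl⟩ := Nat.exists_eq_add_of_le' hn
  have hC : ContDiff ℝ n (fun s => 2 * 4 ^ (p + n) * posPowIntegral (p + n) ((p + n : ℕ) : ℝ) s) :=
    contDiff_const.mul ((contDiff_posPowIntegral _ _).of_le (by exact_mod_cast hn))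
  rw [negDeriv, iteratedDerivWithin_congr hcongr hs,
    iteratedDerivWithin_eq_iteratedDeriv (uniqueDiffOn_Ici 0) hC.contDiffAt hs,
    iteratedDeriv_const_mul_field, iteratedDeriv_posPowIntegral, Nat.add_sub_cancel]
  have h1 : (-1 : ℝ) ^ n * (-1 / 2) ^ n = 1 / 2 ^ n := by
    rw [← mul_pow, ← one_div_pow]; norm_num
  linear_combination (2 * 4 ^ (p + n) * (((p + n).factorial : ℝ) / p.factorial) *
    posPowIntegral (p + n) p s) * h1

/-! ### Fractional integrals of truncated powers -/

lemma integral_rpow_mul_sub_rpow {a b z : ℝ} (ha : 0 < a) (hb : 0 < b) (hz : 0 < z) :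
    ∫ t in 0..z, t ^ (a - 1) * (z - t) ^ (b - 1) =
      z ^ (a + b - 1) * (Real.Gamma a * Real.Gamma b / Real.Gamma (a + b)) := by
  apply Complex.ofReal_injective
  rw [← intervalIntegral.integral_ofReal]
  have h := Complex.betaIntegral_scaled a b hz
  rw [Complex.betaIntegral_eq_Gamma_mul_div _ _ (by simpa using ha) (by simpa using hb)] at h
  have hR : (((z ^ (a + b - 1) * (Real.Gamma a * Real.Gamma b / Real.Gamma (a + b)) : ℝ)) : ℂ) =
      (z : ℂ) ^ ((a : ℂ) + b - 1) *
        (Complex.Gamma a * Complex.Gamma b / Complex.Gamma ((a : ℂ) + b)) := by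
    rw [Complex.ofReal_mul, Complex.ofReal_cpow hz.le, Complex.ofReal_div, Complex.ofReal_mul,
      ← Complex.Gamma_ofReal, ← Complex.Gamma_ofReal, ← Complex.Gamma_ofReal]
    push_cast
    rfl
  rw [hR, ← h]
  refine intervalIntegral.integral_congr fun t ht => ?_
  rw [Set.uIcc_of_le hz.le] at ht
  have h2 : 0 ≤ z - t := by linarith [ht.2]
  simp only [Complex.ofReal_mul]
  rw [Complex.ofReal_cpow ht.1, Complex.ofReal_cpow h2]
  push_cast
  rfl

lemma intervalIntegrable_rpow_mul_sub_rpow {a b z : ℝ} (ha : 0 < a) (hb : 0 < b) (hz : 0 < z) :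
    IntervalIntegrable (fun t : ℝ => t ^ (a - 1) * (z - t) ^ (b - 1)) volume 0 z := by
  -- A non-integrable function has integral 0 by convention, whereas the Beta value is positive.
  by_contra h
  have h1 := integral_rpow_mul_sub_rpow ha hb hz
  rw [intervalIntegral.integral_undef h] at h1
  have := Real.Gamma_pos_of_pos ha
  have := Real.Gamma_pos_of_pos hb
  have := Real.Gamma_pos_of_pos (add_pos ha hb)
  have : 0 < z ^ (a + b - 1) * (Real.Gamma a * Real.Gamma b / Real.Gamma (a + b)) := by positivity
  linarith

/-- The kernel of the fractional integral against a truncated power, as an indicator function. -/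
lemma indicator_fracIntegrand_posPow (ν p v s x : ℝ) :
    (Set.Ioi s).indicator (fracIntegrand ν (fun x => posPow p (v - x / 2)) s) x =
      ((Set.Ioo 0 (2 * v - s)).indicator fun t => (Real.Gamma ν)⁻¹ * (2⁻¹ : ℝ) ^ p *
        (t ^ (ν - 1) * (2 * v - s - t) ^ (p + 1 - 1))) (x - s) := by
  simp only [Set.indicator, Set.mem_Ioi, Set.mem_Ioo, sub_pos]
  by_cases h1 : s < x
  · by_cases h2 : x - s < 2 * v - s
    · have h3 : 0 < v - x / 2 := by linarith
      rw [if_pos h1, if_pos ⟨h1, h2⟩, fracIntegrand, posPow_of_pos _ h3,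
        show v - x / 2 = 2⁻¹ * (2 * v - s - (x - s)) by ring,
        Real.mul_rpow (by norm_num) (by linarith), add_sub_cancel_right]
      ring
    · rw [if_pos h1, if_neg (fun h => h2 h.2), fracIntegrand,
        posPow_of_nonpos _ (by linarith), mul_zero]
  · rw [if_neg h1, if_neg (fun h => h1 h.1)]

lemma integrableOn_fracIntegrand_posPow {ν p : ℝ} (hν : 0 < ν) (hp : 0 ≤ p) (v s : ℝ) :
    IntegrableOn (fracIntegrand ν (fun x => posPow p (v - x / 2)) s) (Set.Ioi s) := by
  rw [← integrable_indicator_iff measurableSet_Ioi]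
  simp_rw [funext (indicator_fracIntegrand_posPow ν p v s)]
  refine Integrable.comp_sub_right ?_ s
  rw [integrable_indicator_iff measurableSet_Ioo]
  rcases lt_or_ge 0 (2 * v - s) with h | h
  · refine Integrable.const_mul ?_ _
    exact ((intervalIntegrable_iff_integrableOn_Ioo_of_le h.le).mp
      (intervalIntegrable_rpow_mul_sub_rpow hν (by linarith) h))
  · rw [Set.Ioo_eq_empty h.not_gt]
    exact integrableOn_empty

/-- The fractional integral of a truncated power is a truncated power. -/
lemma integral_fracIntegrand_posPow {ν p : ℝ} (hν : 0 < ν) (hp : 0 ≤ p) (v s : ℝ) :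
    ∫ x in Set.Ioi s, fracIntegrand ν (fun x => posPow p (v - x / 2)) s x =
      2 ^ ν * (Real.Gamma (p + 1) / Real.Gamma (p + ν + 1)) * posPow (p + ν) (v - s / 2) := by
  rw [← integral_indicator measurableSet_Ioi]
  simp_rw [funext (indicator_fracIntegrand_posPow ν p v s)]
  rw [integral_sub_right_eq_self (fun t => (Set.Ioo 0 (2 * v - s)).indicator _ t) s,
    integral_indicator measurableSet_Ioo]
  rcases lt_or_ge 0 (2 * v - s) with h | h
  · rw [integral_const_mul, ← integral_Ioc_eq_integral_Ioo,
      ← intervalIntegral.integral_of_le h.le,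
      integral_rpow_mul_sub_rpow hν (by linarith) h, posPow_of_pos _ (by linarith : 0 < v - s / 2)]
    have hG := (Real.Gamma_pos_of_pos hν).ne'
    rw [show v - s / 2 = 2⁻¹ * (2 * v - s) by ring, Real.mul_rpow (by norm_num) h.le,
      show ν + (p + 1) - 1 = p + ν by ring, show ν + (p + 1) = p + ν + 1 by ring,
      Real.rpow_add (by norm_num : (0 : ℝ) < 2⁻¹) p ν, Real.inv_rpow zero_le_two ν]
    have h2 : (2 : ℝ) ^ ν ≠ 0 := by positivity
    field_simp
  · rw [Set.Ioo_eq_empty h.not_gt, posPow_of_nonpos _ (by linarith)]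
    simp

/-- This justifies Fubini. Since y² ≤ 1 and x > s ≥ 0, the truncated power is at most the indicator
of x < 2, so the kernel with p = 0, v = 1 dominates uniformly in y. -/
lemma integrable_fracIntegrand_prod (ℓ : ℕ) {ν p s : ℝ} (hν : 0 < ν) (hp : 0 ≤ p) (hs : 0 ≤ s) :
    Integrable (Function.uncurry fun x y : ℝ =>
      fracIntegrand ν (fun x => posPow p (y ^ 2 - x / 2)) s x * (1 - y ^ 2) ^ ℓ)
      ((volume.restrict (Set.Ioi s)).prod (volume.restrict (Set.Ioc 0 1))) := by
  have hdom : Integrable (fun z : ℝ × ℝ => fracIntegrand ν (fun x => posPow 0 (1 - x / 2)) s z.1 * 1)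
      ((volume.restrict (Set.Ioi s)).prod (volume.restrict (Set.Ioc (0 : ℝ) 1))) :=
    (integrableOn_fracIntegrand_posPow hν le_rfl 1 s).mul_prod (integrable_const (1 : ℝ))
  refine hdom.mono' ?_ ?_
  · refine Measurable.aestronglyMeasurable ?_
    unfold fracIntegrand Function.uncurry
    have := (measurable_posPow p).comp (by fun_prop : Measurable fun a : ℝ × ℝ => a.2 ^ 2 - a.1 / 2)
    simp only [Function.comp_def] at this
    fun_prop
  · rw [Measure.prod_restrict]
    filter_upwards [ae_restrict_mem (measurableSet_Ioi.prod measurableSet_Ioc)] with z hz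
    obtain ⟨hx, hy⟩ := hz
    have hx' : s < z.1 := hx
    obtain ⟨hw0, hw1⟩ := one_sub_sq_pow_mem_Icc ℓ hy
    have hΓ := Real.Gamma_pos_of_pos hν
    have hk : 0 ≤ (z.1 - s) ^ (ν - 1) / Real.Gamma ν :=
      div_nonneg (Real.rpow_nonneg (by linarith) _) hΓ.le
    have hy2 : z.2 ^ 2 ≤ 1 := by nlinarith [hy.1, hy.2]
    have hle : posPow p (z.2 ^ 2 - z.1 / 2) ≤ posPow 0 (1 - z.1 / 2) := by
      rcases lt_or_ge 0 (1 - z.1 / 2) with h | h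
      · rw [posPow_of_pos 0 h, Real.rpow_zero, ← Real.one_rpow p]
        exact posPow_le_rpow hp zero_le_one (by linarith)
      · rw [posPow_of_nonpos 0 h, posPow_of_nonpos p (by linarith)]
    have h0 := posPow_nonneg p (z.2 ^ 2 - z.1 / 2)
    have h1 := mul_nonneg hk (posPow_nonneg 0 (1 - z.1 / 2))
    simp only [Function.uncurry, fracIntegrand]
    rw [Real.norm_of_nonneg (by positivity)]
    gcongr

lemma fracIntegrand_posPowIntegral (ℓ : ℕ) (ν p s x : ℝ) :
    fracIntegrand ν (posPowIntegral ℓ p) s x =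
      ∫ y in Set.Ioc 0 1, fracIntegrand ν (fun x => posPow p (y ^ 2 - x / 2)) s x *
        (1 - y ^ 2) ^ ℓ := by
  simp only [fracIntegrand, posPowIntegral, mul_assoc]
  rw [integral_const_mul]

lemma integrableOn_fracIntegrand_posPowIntegral (ℓ : ℕ) {ν p s : ℝ} (hν : 0 < ν) (hp : 0 ≤ p)
    (hs : 0 ≤ s) : IntegrableOn (fracIntegrand ν (posPowIntegral ℓ p) s) (Set.Ioi s) := by
  rw [funext (fracIntegrand_posPowIntegral ℓ ν p s)]
  exact (integrable_fracIntegrand_prod ℓ hν hp hs).integral_prod_left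

lemma integral_fracIntegrand_posPowIntegral (ℓ : ℕ) {ν p s : ℝ} (hν : 0 < ν) (hp : 0 ≤ p)
    (hs : 0 ≤ s) :
    ∫ x in Set.Ioi s, fracIntegrand ν (posPowIntegral ℓ p) s x =
      2 ^ ν * (Real.Gamma (p + 1) / Real.Gamma (p + ν + 1)) * posPowIntegral ℓ (p + ν) s := by
  simp_rw [fracIntegrand_posPowIntegral ℓ ν p s]
  rw [integral_integral_swap (integrable_fracIntegrand_prod ℓ hν hp hs), posPowIntegral,
    ← integral_const_mul]
  refine integral_congr_ae (Filter.Eventually.of_forall fun y => ?_)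
  simp only
  rw [integral_mul_const, integral_fracIntegrand_posPow hν hp]
  ring

lemma fracIntegrand_negDeriv (ℓ n : ℕ) (hn : n ≤ ℓ) {s x : ℝ} (hs : 0 ≤ s) (hx : s < x) (ν : ℝ) :
    fracIntegrand ν (negDeriv n (fForm (radialConv (truncPow ℓ) (truncPow ℓ)))) s x =
      2 * 4 ^ ℓ / 2 ^ n * (ℓ.factorial / (ℓ - n).factorial) *
        fracIntegrand ν (posPowIntegral ℓ ((ℓ - n : ℕ) : ℝ)) s x := by
  rw [fracIntegrand, negDeriv_fForm_radialConv ℓ n hn (hs.trans hx.le), fracIntegrand]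
  ring

lemma fracDerivExistsAt_fForm_radialConv (ℓ : ℕ) {k s : ℝ} (hkℓ : k ≤ ℓ) (hs : 0 ≤ s) :
    FracDerivExistsAt k (fForm (radialConv (truncPow ℓ) (truncPow ℓ))) s := by
  have hn : ⌈k⌉₊ ≤ ℓ := Nat.ceil_le.mpr hkℓ
  refine ⟨contDiffOn_fForm_radialConv ℓ _ hn, fun hne => ?_⟩
  have hν : 0 < (⌈k⌉₊ : ℝ) - k := sub_pos.mpr (lt_of_le_of_ne (Nat.le_ceil k) hne.symm)
  refine ((integrableOn_fracIntegrand_posPowIntegral ℓ hν (Nat.cast_nonneg (ℓ - ⌈k⌉₊)) hs).const_mul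
    (2 * 4 ^ ℓ / 2 ^ ⌈k⌉₊ * (ℓ.factorial / (ℓ - ⌈k⌉₊).factorial))).congr ?_
  filter_upwards [ae_restrict_mem measurableSet_Ioi] with x hx
  exact (fracIntegrand_negDeriv ℓ _ hn hs hx _).symm

/-- With n = ⌈k⌉, the n derivatives lower the exponent to ℓ - n with factor ℓ!/(ℓ - n)!, and I_{n-k}
raises it to ℓ - k with factor Γ(ℓ - n + 1)/Γ(ℓ - k + 1). The factors (ℓ - n)! cancel and n
disappears. -/
lemma fracDeriv_fForm_radialConv (ℓ : ℕ) {k s : ℝ} (hkℓ : k ≤ ℓ) (hs : 0 ≤ s) :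
    fracDeriv k (fForm (radialConv (truncPow ℓ) (truncPow ℓ))) s =
      (2 : ℝ) ^ (2 * (ℓ : ℝ) - k + 1) * Real.Gamma (ℓ + 1) / Real.Gamma (ℓ - k + 1) *
        posPowIntegral ℓ (ℓ - k) s := by
  have hn : ⌈k⌉₊ ≤ ℓ := Nat.ceil_le.mpr hkℓ
  have hfac : ((ℓ - ⌈k⌉₊).factorial : ℝ) = Real.Gamma (((ℓ - ⌈k⌉₊ : ℕ) : ℝ) + 1) :=
    (Real.Gamma_nat_eq_factorial _).symm
  have hcast : ((ℓ - ⌈k⌉₊ : ℕ) : ℝ) = ℓ - ⌈k⌉₊ := Nat.cast_sub hn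
  have hpow : (2 : ℝ) ^ (2 * (ℓ : ℝ) - k + 1) = 2 * 4 ^ ℓ / 2 ^ ⌈k⌉₊ * 2 ^ ((⌈k⌉₊ : ℝ) - k) := by
    rw [← Real.rpow_natCast 2 ⌈k⌉₊, show (2 : ℝ) * 4 ^ ℓ = 2 ^ (2 * (ℓ : ℝ) + 1) by
      rw [Real.rpow_add two_pos, Real.rpow_mul zero_le_two]; norm_num; ring,
      ← Real.rpow_sub two_pos, ← Real.rpow_add two_pos]
    ring_nf
  rw [fracDeriv, fracInt, hpow]
  split_ifs with h0
  · have hk : (⌈k⌉₊ : ℝ) = k := by linarith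
    rw [negDeriv_fForm_radialConv ℓ _ hn hs, hfac, h0, hcast, hk, Real.rpow_zero,
      Real.Gamma_nat_eq_factorial]
    ring
  · have hν : 0 < (⌈k⌉₊ : ℝ) - k := lt_of_le_of_ne (sub_nonneg.mpr (Nat.le_ceil k)) (Ne.symm h0)
    rw [setIntegral_congr_fun measurableSet_Ioi
      (fun x hx => fracIntegrand_negDeriv ℓ _ hn hs hx _), integral_const_mul,
      integral_fracIntegrand_posPowIntegral ℓ hν (Nat.cast_nonneg _) hs, hfac,
      Real.Gamma_nat_eq_factorial ℓ]
    have hG : Real.Gamma (((ℓ - ⌈k⌉₊ : ℕ) : ℝ) + 1) ≠ 0 :=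
      (Real.Gamma_pos_of_pos (by positivity)).ne'
    have hsum : ((ℓ - ⌈k⌉₊ : ℕ) : ℝ) + (⌈k⌉₊ - k) = ℓ - k := by rw [hcast]; ring
    rw [hsum]
    field_simp

/-! ### Pochhammer symbols and the hypergeometric series on [0, 1] -/

lemma poch_zero (a : ℝ) : poch a 0 = 1 := by simp [poch]

lemma poch_succ (a : ℝ) (m : ℕ) : poch a (m + 1) = poch a m * (a + m) := by
  rw [poch, ascPochhammer_succ_eval, poch]

lemma poch_succ_left (a : ℝ) (m : ℕ) : poch a (m + 1) = a * poch (a + 1) m := by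
  simp [poch, ascPochhammer_succ_left]

lemma poch_pos {a : ℝ} (ha : 0 < a) (m : ℕ) : 0 < poch a m := ascPochhammer_pos m a ha

lemma factorial_le_poch {a : ℝ} (ha : 1 ≤ a) (m : ℕ) : (m.factorial : ℝ) ≤ poch a m := by
  induction m with
  | zero => simp [poch_zero]
  | succ m ih =>
    rw [poch_succ, Nat.factorial_succ, Nat.cast_mul, mul_comm]
    have : ((m + 1 : ℕ) : ℝ) ≤ a + m := by push_cast; linarith
    have := (m.factorial.cast_nonneg : (0 : ℝ) ≤ m.factorial).trans ih
    gcongr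

lemma Gamma_add_natCast {c : ℝ} (hc : 0 < c) (m : ℕ) :
    Real.Gamma (c + m) = Real.Gamma c * poch c m := by
  induction m with
  | zero => simp [poch_zero]
  | succ m ih =>
    have h : c + (m : ℝ) ≠ 0 := by positivity
    rw [Nat.cast_succ, ← add_assoc, Real.Gamma_add_one h, ih, poch_succ]
    ring

lemma hasSum_poch_mul_pow (a : ℝ) {t : ℝ} (ht : |t| < 1) :
    HasSum (fun m : ℕ => poch a m / m.factorial * t ^ m) ((1 - t) ^ (-a)) := by
  have h := (Real.one_div_one_sub_rpow_hasFPowerSeriesOnBall_zero a).hasSum (y := t)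
    (by simpa [← ofReal_norm] using ht)
  rw [zero_add] at h
  rw [Real.rpow_neg (by linarith [le_abs_self t]), ← one_div]
  have hterm : ∀ m : ℕ, poch a m / m.factorial * t ^ m =
      FormalMultilinearSeries.ofScalars ℝ (fun n : ℕ => Ring.choose (a + n - 1) n) m fun _ => t := by
    intro m
    rw [FormalMultilinearSeries.ofScalars_apply_eq, smul_eq_mul, Ring.choose_eq_smul,
      Polynomial.descPochhammer_smeval_eq_ascPochhammer,
      Polynomial.ascPochhammer_smeval_eq_eval, poch, show a + m - 1 - m + 1 = a by ring]
    simp only [smul_eq_mul]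
    ring
  rw [funext hterm]
  exact h

/-- The binomial series of a positive exponent `-a` converges absolutely on the unit circle. -/
lemma summable_abs_poch_div_factorial {a : ℝ} (ha : a < 0) :
    Summable fun m : ℕ => |poch a m| / m.factorial := by
  set b : ℕ → ℝ := fun m => |poch a m| / m.factorial with hb
  obtain ⟨N, hN⟩ := exists_nat_ge (-a)
  have hb0 : ∀ m, 0 ≤ b m := fun m => by positivity
  -- Beyond -a the factor a + m is nonnegative, so (m + 1) b(m + 1) = (a + m) b(m) and the sum of
  -- the b(m) telescopes.
  have hstep : ∀ m : ℕ, -a ≤ m → -a * b m = m * b m - (m + 1 : ℕ) * b (m + 1) := by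
    intro m hm
    have h1 : 0 ≤ a + m := by linarith
    have h2 : (m.factorial : ℝ) ≠ 0 := by positivity
    have h3 : (m : ℝ) + 1 ≠ 0 := by positivity
    simp only [hb]
    rw [poch_succ, abs_mul, abs_of_nonneg h1, Nat.factorial_succ]
    push_cast
    field_simp
    ring
  rw [← summable_nat_add_iff N]
  refine summable_of_sum_range_le (c := N * b N / -a) (fun m => hb0 _) fun M => ?_
  rw [le_div_iff₀ (by linarith)]
  have htel : (∑ i ∈ Finset.range M, b (i + N)) * -a = N * b N - (M + N : ℕ) * b (M + N) := by
    induction M with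
    | zero => simp
    | succ M ih =>
      rw [Finset.sum_range_succ, add_mul, ih, mul_comm (b (M + N)), hstep (M + N)
        (by push_cast; linarith [(Nat.cast_nonneg M : (0 : ℝ) ≤ M)]),
        show M + 1 + N = M + N + 1 by ring]
      ring
  have : 0 ≤ ((M + N : ℕ) : ℝ) * b (M + N) := mul_nonneg (Nat.cast_nonneg _) (hb0 _)
  linarith

lemma summable_abs_poch_div_poch {a c : ℝ} (ha : a < 0) (hc : 1 ≤ c) :
    Summable fun m : ℕ => |poch a m| / poch c m := by
  refine (summable_abs_poch_div_factorial ha).of_nonneg_of_le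
    (fun m => div_nonneg (abs_nonneg _) (poch_pos (by linarith) m).le) fun m => ?_
  have := factorial_le_poch hc m
  gcongr

lemma ordinaryHypergeometricCoefficient_one (a c : ℝ) (m : ℕ) :
    ordinaryHypergeometricCoefficient a 1 c m = poch a m / poch c m := by
  have h : (m.factorial : ℝ) ≠ 0 := by positivity
  rw [ordinaryHypergeometricCoefficient, ascPochhammer_eval_one]
  simp only [poch]
  field_simp

lemma summable_hypergeometric {a c z : ℝ} (ha : a < 0) (hc : 1 ≤ c) (hz0 : 0 ≤ z) (hz1 : z ≤ 1) :
    Summable fun m : ℕ => ordinaryHypergeometricCoefficient a 1 c m * z ^ m := by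
  refine Summable.of_norm_bounded (summable_abs_poch_div_poch ha hc) fun m => ?_
  rw [ordinaryHypergeometricCoefficient_one, norm_mul, norm_div, norm_pow, Real.norm_eq_abs,
    Real.norm_of_nonneg (poch_pos (by linarith) m).le, Real.norm_of_nonneg hz0]
  exact mul_le_of_le_one_right (div_nonneg (abs_nonneg _) (poch_pos (by linarith) m).le)
    (pow_le_one₀ hz0 hz1)

lemma hasSum_ordinaryHypergeometric_sub_one {a c z : ℝ} (ha : a < 0) (hc : 1 ≤ c) (hz0 : 0 ≤ z)
    (hz1 : z ≤ 1) :
    HasSum (fun m : ℕ => poch a (m + 1) / poch c (m + 1) * z ^ (m + 1))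
      (ordinaryHypergeometric a 1 c z - 1) := by
  have hs := (summable_hypergeometric ha hc hz0 hz1).hasSum
  rw [← hasSum_nat_add_iff' 1] at hs
  have h0 : ordinaryHypergeometric a 1 c z - 1 =
      ∑' m : ℕ, ordinaryHypergeometricCoefficient a 1 c m * z ^ m -
        ∑ i ∈ Finset.range 1, ordinaryHypergeometricCoefficient a 1 c i * z ^ i := by
    rw [ordinaryHypergeometric_eq_tsum, Finset.sum_range_one, ordinaryHypergeometricCoefficient_one,
      poch_zero, poch_zero, div_one, pow_zero, mul_one]
    rfl
  rw [h0]
  simpa only [ordinaryHypergeometricCoefficient_one] using hs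

/-- Euler's integral for `₂F₁(a, 1; q + 1; z)`, in the form obtained after one integration by
parts. -/
lemma integral_sub_rpow_mul_one_sub_rpow {a q z : ℝ} (ha : a < 0) (hq : 0 ≤ q) (hz0 : 0 ≤ z)
    (hz1 : z ≤ 1) :
    a * ∫ t in Set.Ioo 0 z, (z - t) ^ q * (1 - t) ^ (-(a + 1)) =
      z ^ q * (ordinaryHypergeometric a 1 (q + 1) z - 1) := by
  rcases hz0.eq_or_lt with rfl | hz
  · simp
  have hterm : ∀ m : ℕ, ∫ t in Set.Ioo 0 z, t ^ m * (z - t) ^ q =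
      z ^ q * (m.factorial / poch (q + 1) (m + 1) * z ^ (m + 1)) := by
    intro m
    have h := integral_rpow_mul_sub_rpow (a := m + 1) (b := q + 1) (by positivity) (by positivity) hz
    rw [intervalIntegral.integral_of_le hz.le, integral_Ioc_eq_integral_Ioo] at h
    simp only [add_sub_cancel_right, Real.rpow_natCast] at h
    have hG : Real.Gamma (q + 1) ≠ 0 := (Real.Gamma_pos_of_pos (by positivity)).ne'
    rw [h, Real.Gamma_nat_eq_factorial,
      show (m : ℝ) + 1 + (q + 1) = q + 1 + (m + 1 : ℕ) by push_cast; ring,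
      Gamma_add_natCast (by positivity), show q + 1 + ((m + 1 : ℕ) : ℝ) - 1 = q + (m + 1 : ℕ) by ring,
      Real.rpow_add hz, Real.rpow_natCast]
    field_simp
  have hint : ∀ m : ℕ, IntegrableOn (fun t : ℝ => t ^ m * (z - t) ^ q) (Set.Ioo 0 z) := by
    intro m
    have h := intervalIntegrable_rpow_mul_sub_rpow (a := m + 1) (b := q + 1)
      (by positivity) (by positivity) hz
    simp only [add_sub_cancel_right, Real.rpow_natCast] at h
    exact (intervalIntegrable_iff_integrableOn_Ioo_of_le hz.le).mp h
  have hnorm : ∀ m : ℕ, ∫ t in Set.Ioo 0 z,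
      ‖poch (a + 1) m / m.factorial * (t ^ m * (z - t) ^ q)‖ =
      z ^ q / |a| * (|poch a (m + 1)| / poch (q + 1) (m + 1) * z ^ (m + 1)) := by
    intro m
    have h1 : ∀ t ∈ Set.Ioo 0 z, ‖poch (a + 1) m / m.factorial * (t ^ m * (z - t) ^ q)‖ =
        |poch (a + 1) m| / m.factorial * (t ^ m * (z - t) ^ q) := by
      intro t ht
      have h2 : 0 ≤ t := ht.1.le
      have h3 : 0 ≤ z - t := by linarith [ht.2]
      rw [norm_mul, Real.norm_of_nonneg (by positivity : 0 ≤ t ^ m * (z - t) ^ q), norm_div,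
        Real.norm_eq_abs, Real.norm_of_nonneg (by positivity)]
    rw [setIntegral_congr_fun measurableSet_Ioo h1, integral_const_mul, hterm, poch_succ_left a,
      abs_mul]
    have h4 : |a| ≠ 0 := abs_ne_zero.mpr ha.ne
    field_simp
  -- The binomial series of (1 - t)^(-(a+1)) is integrated termwise. The L¹ norms are summable even
  -- at z = 1, which is needed for r = 0. The prefactor a turns (a + 1)^{(m)} into (a)^{(m+1)},
  -- giving the series without its constant term.
  have hsum := hasSum_integral_of_summable_integral_norm
    (F := fun (m : ℕ) (t : ℝ) => poch (a + 1) m / m.factorial * (t ^ m * (z - t) ^ q))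
    (μ := volume.restrict (Set.Ioo 0 z)) (fun m => (hint m).const_mul _) (by
      simp_rw [hnorm]
      refine Summable.mul_left _ (Summable.of_nonneg_of_le (fun m => ?_) (fun m => ?_)
        ((summable_nat_add_iff 1).mpr (summable_abs_poch_div_poch ha (by linarith : 1 ≤ q + 1))))
      · have := poch_pos (by linarith : 0 < q + 1) (m + 1)
        positivity
      · have := poch_pos (by linarith : 0 < q + 1) (m + 1)
        exact mul_le_of_le_one_right (by positivity) (pow_le_one₀ hz0 hz1))
  have hval : ∫ t in Set.Ioo 0 z, ∑' m : ℕ,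
      poch (a + 1) m / m.factorial * (t ^ m * (z - t) ^ q) =
      ∫ t in Set.Ioo 0 z, (z - t) ^ q * (1 - t) ^ (-(a + 1)) := by
    refine setIntegral_congr_fun measurableSet_Ioo fun t ht => ?_
    have h := (hasSum_poch_mul_pow (a + 1) (t := t)
      (by rw [abs_of_pos ht.1]; linarith [ht.2])).mul_left ((z - t) ^ q)
    refine Eq.trans (tsum_congr fun m => ?_) h.tsum_eq
    ring
  rw [hval] at hsum
  refine (hsum.mul_left a).unique ?_
  convert (hasSum_ordinaryHypergeometric_sub_one ha (by linarith : 1 ≤ q + 1) hz0 hz1).mul_left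
    (z ^ q) using 2 with m
  rw [integral_const_mul, hterm, poch_succ_left a]
  field_simp

/-! ### Evaluation in closed form -/

/-- Substitute t = 1 - y² in Euler's integral with a = -n - 1/2: then (1 - t)^(-(a+1)) = y^(2n-1),
the Jacobian 2y restores the even power, and 2a = -(2n + 1). -/
lemma setIntegral_sq_sub_sq_rpow {c q : ℝ} (hc0 : 0 ≤ c) (hc1 : c ≤ 1) (hq : 0 ≤ q) (n : ℕ) :
    ∫ y in Set.Ioc c 1, (y ^ 2 - c ^ 2) ^ q * (y ^ 2) ^ n =
      (1 - c ^ 2) ^ q * ((1 - ordinaryHypergeometric (-(n : ℝ) - 1 / 2) 1 (q + 1) (1 - c ^ 2))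
        / (2 * n + 1)) := by
  have ha : -(n : ℝ) - 1 / 2 < 0 := by linarith [(Nat.cast_nonneg n : (0 : ℝ) ≤ n)]
  have hz0 : 0 ≤ 1 - c ^ 2 := by nlinarith
  have h := integral_sub_rpow_mul_one_sub_rpow ha hq hz0 (by nlinarith)
  have himg : (fun y : ℝ => 1 - y ^ 2) '' Set.Ioo c 1 = Set.Ioo 0 (1 - c ^ 2) := by
    ext t
    simp only [Set.mem_image, Set.mem_Ioo]
    constructor
    · rintro ⟨y, ⟨h1, h2⟩, rfl⟩
      exact ⟨by nlinarith, by nlinarith⟩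
    · rintro ⟨h1, h2⟩
      refine ⟨√(1 - t), ⟨Real.lt_sqrt_of_sq_lt (by linarith), ?_⟩, ?_⟩
      · rw [Real.sqrt_lt' one_pos]; linarith
      · rw [Real.sq_sqrt (by nlinarith)]; ring
  have hsub := integral_image_eq_integral_abs_deriv_smul (s := Set.Ioo c 1)
    (f := fun y : ℝ => 1 - y ^ 2) (f' := fun y => -(2 * y)) measurableSet_Ioo
    (fun y _ => by
      have := ((hasDerivAt_pow 2 y).const_sub 1).hasDerivWithinAt (s := Set.Ioo c 1)
      simpa using this)
    (fun x hx y hy hxy => by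
      have hx0 : 0 < x := hc0.trans_lt hx.1
      have hy0 : 0 < y := hc0.trans_lt hy.1
      have : x ^ 2 = y ^ 2 := by simpa using hxy
      nlinarith [(pow_left_inj₀ hx0.le hy0.le two_ne_zero).mp this])
    (fun t => (1 - c ^ 2 - t) ^ q * (1 - t) ^ (-(-(n : ℝ) - 1 / 2 + 1)))
  rw [himg] at hsub
  rw [hsub] at h
  have hcongr : ∀ y ∈ Set.Ioo c 1, |-(2 * y)| • ((1 - c ^ 2 - (1 - y ^ 2)) ^ q *
      (1 - (1 - y ^ 2)) ^ (-(-(n : ℝ) - 1 / 2 + 1))) =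
      2 * ((y ^ 2 - c ^ 2) ^ q * (y ^ 2) ^ n) := by
    intro y hy
    have hy0 : 0 < y := hc0.trans_lt hy.1
    have hpow : (y ^ 2) ^ (-(-(n : ℝ) - 1 / 2 + 1)) = (y ^ 2) ^ n / y := by
      rw [show -(-(n : ℝ) - 1 / 2 + 1) = n - 1 / 2 by ring, Real.rpow_sub (by positivity),
        Real.rpow_natCast, ← Real.sqrt_eq_rpow, Real.sqrt_sq hy0.le]
    rw [abs_neg, abs_of_pos (by positivity), smul_eq_mul, sub_sub_cancel, hpow,
      show 1 - c ^ 2 - (1 - y ^ 2) = y ^ 2 - c ^ 2 by ring]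
    field_simp
  rw [setIntegral_congr_fun measurableSet_Ioo hcongr, integral_const_mul] at h
  rw [integral_Ioc_eq_integral_Ioo]
  rw [← mul_div_assoc, eq_div_iff (by positivity)]
  linear_combination -h

lemma one_sub_pow_eq_sum_poch (ℓ : ℕ) (x : ℝ) :
    (1 - x) ^ ℓ = ∑ n ∈ Finset.range (ℓ + 1), poch (-(ℓ : ℝ)) n * (1 / (n.factorial : ℝ)) * x ^ n := by
  rw [sub_eq_neg_add, add_pow]
  refine Finset.sum_congr rfl fun n _ => ?_
  have h : (n.factorial : ℝ) ≠ 0 := by positivity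
  rw [poch, ascPochhammer_eval_neg_eq_descPochhammer, descPochhammer_eval_eq_descFactorial,
    Nat.descFactorial_eq_factorial_mul_choose, neg_pow, one_pow]
  push_cast
  field_simp

lemma poch_half_div_poch (n : ℕ) : poch (1 / 2) n / poch (3 / 2) n = 1 / (2 * n + 1) := by
  have h3 := poch_pos (by norm_num : (0 : ℝ) < 3 / 2) n
  have h := poch_succ_left (1 / 2) n
  rw [poch_succ, show (1 / 2 : ℝ) + 1 = 3 / 2 by norm_num] at h
  rw [div_eq_div_iff h3.ne' (by positivity)]
  linear_combination 2 * h

/-- Integrating the derivative of y(1 - y²)^(ℓ+1), which vanishes at both ends, gives the ratio (ℓ +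
1)/(ℓ + 3/2) of consecutive integrals. -/
lemma integral_one_sub_sq_pow (ℓ : ℕ) :
    ∫ y in (0 : ℝ)..1, (1 - y ^ 2) ^ ℓ = poch 1 ℓ / poch (3 / 2) ℓ := by
  induction ℓ with
  | zero => simp [poch_zero]
  | succ ℓ ih =>
    have hder : ∀ y ∈ Set.uIcc (0 : ℝ) 1, HasDerivAt (fun y : ℝ => y * (1 - y ^ 2) ^ (ℓ + 1))
        ((2 * ℓ + 3) * (1 - y ^ 2) ^ (ℓ + 1) - (2 * (ℓ + 1)) * (1 - y ^ 2) ^ ℓ) y := by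
      intro y _
      have h := (hasDerivAt_id y).mul (((hasDerivAt_pow 2 y).const_sub 1).pow (ℓ + 1))
      refine h.congr_deriv ?_
      simp
      ring
    have hi : ∀ (m : ℕ) (b : ℝ), IntervalIntegrable
        (fun y : ℝ => b * (1 - y ^ 2) ^ m) volume 0 1 :=
      fun m b => (by fun_prop : Continuous _).intervalIntegrable _ _
    have key := intervalIntegral.integral_eq_sub_of_hasDerivAt hder ((hi _ _).sub (hi _ _))
    rw [intervalIntegral.integral_sub (hi _ _) (hi _ _), intervalIntegral.integral_const_mul,
      intervalIntegral.integral_const_mul, ih] at key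
    have h3 := (poch_pos (by norm_num : (0 : ℝ) < 3 / 2) ℓ).ne'
    have h4 : (3 / 2 : ℝ) + ℓ ≠ 0 := by positivity
    rw [poch_succ, poch_succ, eq_div_iff (mul_ne_zero h3 h4)]
    simp at key
    field_simp at key ⊢
    linear_combination key

/-- Both sides evaluate ∫_0^1 (1 - y²)^ℓ dy, the left one after binomial expansion. -/
lemma sum_poch_div (ℓ : ℕ) :
    ∑ n ∈ Finset.range (ℓ + 1), poch (-(ℓ : ℝ)) n * (1 / (n.factorial : ℝ)) * (1 / (2 * n + 1)) =
      poch 1 ℓ / poch (3 / 2) ℓ := by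
  rw [← integral_one_sub_sq_pow]
  simp_rw [one_sub_pow_eq_sum_poch ℓ]
  rw [intervalIntegral.integral_finsetSum
    fun n _ => (by fun_prop : Continuous _).intervalIntegrable _ _]
  refine Finset.sum_congr rfl fun n _ => ?_
  rw [intervalIntegral.integral_const_mul]
  simp_rw [← pow_mul]
  rw [integral_pow]
  simp

lemma posPowIntegral_eq_hypergeometric (ℓ : ℕ) {c q s : ℝ} (hc0 : 0 ≤ c) (hc1 : c ≤ 1) (hq : 0 ≤ q)
    (hs : s / 2 = c ^ 2) :
    posPowIntegral ℓ q s = (1 - c ^ 2) ^ q * (poch 1 ℓ / poch (3 / 2) ℓ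
      - ∑ n ∈ Finset.range (ℓ + 1),
          poch (-(ℓ : ℝ)) n * poch (1 / 2) n / poch (3 / 2) n * (1 / (n.factorial : ℝ))
            * ordinaryHypergeometric (-(n : ℝ) - 1 / 2) 1 (q + 1) (1 - c ^ 2)) := by
  rw [posPowIntegral_eq_setIntegral ℓ q hc0 hs]
  have hexp : ∀ y : ℝ, (y ^ 2 - c ^ 2) ^ q * (1 - y ^ 2) ^ ℓ = ∑ n ∈ Finset.range (ℓ + 1),
      poch (-(ℓ : ℝ)) n * (1 / (n.factorial : ℝ)) * ((y ^ 2 - c ^ 2) ^ q * (y ^ 2) ^ n) := by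
    intro y
    rw [one_sub_pow_eq_sum_poch, Finset.mul_sum]
    exact Finset.sum_congr rfl fun n _ => by ring
  simp_rw [hexp]
  have hcont : ∀ n : ℕ, Continuous fun y : ℝ => (y ^ 2 - c ^ 2) ^ q * (y ^ 2) ^ n := fun n =>
    ((by fun_prop : Continuous fun y : ℝ => y ^ 2 - c ^ 2).rpow_const fun _ => Or.inr hq).mul
      (by fun_prop)
  rw [integral_finsetSum _ fun n _ =>
    (((hcont n).integrableOn_Icc).mono_set Set.Ioc_subset_Icc_self).const_mul _]
  rw [← sum_poch_div, ← Finset.sum_sub_distrib, Finset.mul_sum]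
  refine Finset.sum_congr rfl fun n _ => ?_
  rw [integral_const_mul, setIntegral_sq_sub_sq_rpow hc0 hc1 hq, mul_div_assoc (poch (-(ℓ : ℝ)) n),
    poch_half_div_poch]
  ring

end WuFunction

theorem theorem4p4 (ℓ : ℕ) (k : ℝ) (hk : 0 ≤ k) (hkℓ : k ≤ ℓ) (r : ℝ) (hr : 0 ≤ r) (hr2 : r ≤ 2) :
    -- `𝒟^k (f_ℓ * f_ℓ)` exists at `r`
    WuFunction.FracDerivExistsAt k
      (WuFunction.fForm
        (WuFunction.radialConv (WuFunction.truncPow ℓ) (WuFunction.truncPow ℓ))) (r ^ 2 / 2) ∧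
    -- the hypergeometric series in the formula converge
    (∀ n ∈ Finset.range (ℓ + 1), Summable fun m : ℕ =>
      ordinaryHypergeometricCoefficient (-(n : ℝ) - 1 / 2) 1 (ℓ - k + 1) m
        * (1 - r ^ 2 / 4) ^ m) ∧
    -- the closed form
    WuFunction.wu ℓ k r =
      (2 : ℝ) ^ (2 * (ℓ : ℝ) - k + 1) * Real.Gamma (ℓ + 1) / Real.Gamma (ℓ - k + 1)
        * (1 - r ^ 2 / 4) ^ ((ℓ : ℝ) - k)
        * (WuFunction.poch 1 ℓ / WuFunction.poch (3 / 2) ℓ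
          - ∑ n ∈ Finset.range (ℓ + 1),
              WuFunction.poch (-(ℓ : ℝ)) n * WuFunction.poch (1 / 2) n / WuFunction.poch (3 / 2) n
                * (1 / (n.factorial : ℝ))
                * ordinaryHypergeometric (-(n : ℝ) - 1 / 2) 1 ((ℓ : ℝ) - k + 1)
                    (1 - r ^ 2 / 4)) := by
  have hs : 0 ≤ r ^ 2 / 2 := by positivity
  have hq : 0 ≤ (ℓ : ℝ) - k := sub_nonneg.mpr hkℓ
  refine ⟨WuFunction.fracDerivExistsAt_fForm_radialConv ℓ hkℓ hs, fun n _ => ?_, ?_⟩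
  · exact WuFunction.summable_hypergeometric
      (by linarith [(Nat.cast_nonneg n : (0 : ℝ) ≤ n)]) (by linarith) (by nlinarith) (by nlinarith)
  · rw [WuFunction.wu, WuFunction.walkD, WuFunction.fFormInv,
      WuFunction.fracDeriv_fForm_radialConv ℓ hkℓ hs,
      WuFunction.posPowIntegral_eq_hypergeometric ℓ (c := r / 2) (by positivity) (by linarith) hq
        (by ring),
      show (r / 2) ^ 2 = r ^ 2 / 4 by ring]
    ring
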